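/- Let $n\in\mathbb N$ and let $\phi:\mathbb R^n\to\mathbb R$ be a $\mathcal C^2$ strictly convex function such that $\lim_{\|x\|\to\infty}\phi(x)/\|x\|=+\infty$ and such that $\mu_\phi(dx)=e^{-\phi(x)}\,dx$ is a probability measure. Assume moreover that for every $R>0$ and every measurable map $y_0:\mathbb R^n\to\mathbb R^n$ satisfying $\|\nabla\phi(y_0(z))\|\le\|\nabla\phi(z)\|+R$ for all $z$, $$\int\big(\|z\|+\|y_0(z)\|+R\big)^2\Big(\|\nabla\phi(z)\|+\sup_{y:\,\|y-z+y_0(z)\|\le R}\|\mathrm{Hess}(\phi)(y)\|\Big)\,d\mu_\phi(z)<+\infty .$$ Here $\|\cdot\|$ is the Euclidean norm on vectors and the operator norm on Hessians. Let $\phi^*(x)=\sup_{z\in\mathbb R^n}\{x\cdot z-\phi(z)\}$ be the Fenchel--Legendre transform of $\phi$, and let $\mathrm{Ent}_{dx}(f)=\int f\log\frac{f}{\int f\,dx}\,dx$ be the entropy with respect to Lebesgue measure. For $\lambda>0$, call $g:\mathbb R^n\to\mathbb R$ $\lambda$-admissible if $g$ is $\mathcal C^1$ and $e^g$, $g\,e^g$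 and $\phi^*(-\lambda\nabla g)\,e^g$ are Lebesgue integrable. (i) For every $\lambda>0$ and every $\lambda$-admissible $g$, $$\mathrm{Ent}_{dx}(e^g)\le -n\log(\lambda e)\int e^g\,dx+\int\phi^*(-\lambda\nabla g)\,e^g\,dx .$$ (ii) The inequality is optimal: for every $\bar x\in\mathbb R^n$ the function $g(x)=-\phi(x-\bar x)$ is $1$-admissible, and equality holds in (i) for this $g$ and $\lambda=1$. -/

import Mathlib

open MeasureTheory Filter Topology
open scoped Gradient

noncomputable section

/-- The Fenchel-Legendre transform `φ*(x) = sup_z (x · z - φ z)`. It is a genuine (finite)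
supremum for every superlinear continuous `φ`. -/
def fenchelLegendre {n : ℕ} (φ : EuclideanSpace ℝ (Fin n) → ℝ)
    (x : EuclideanSpace ℝ (Fin n)) : ℝ :=
  ⨆ z : EuclideanSpace ℝ (Fin n), (inner ℝ x z - φ z)

/-- The entropy `Ent_μ(f) = ∫ f log (f / ∫ f dμ) dμ`. -/
def entropy {Ω : Type*} [MeasurableSpace Ω] (μ : Measure Ω) (f : Ω → ℝ) : ℝ :=
  ∫ x, f x * Real.log (f x / ∫ y, f y ∂μ) ∂μ

/-- The measure `μ_φ(dx) = e^{-φ(x)} dx` with potential `φ`. -/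
def potentialMeasure {n : ℕ} (φ : EuclideanSpace ℝ (Fin n) → ℝ) :
    Measure (EuclideanSpace ℝ (Fin n)) :=
  volume.withDensity (fun x => ENNReal.ofReal (Real.exp (-φ x)))

/-- The Hessian of `φ` at `y`, as a linear operator; its norm below is the operator norm. -/
def hessian {n : ℕ} (φ : EuclideanSpace ℝ (Fin n) → ℝ) (y : EuclideanSpace ℝ (Fin n)) :
    EuclideanSpace ℝ (Fin n) →L[ℝ] EuclideanSpace ℝ (Fin n) :=
  fderiv ℝ (∇ φ) y

/-- The conditions on the potential `φ`. The point `y₀ = y₀(z)` of the moment condition is an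
arbitrary measurable choice subject to `‖∇φ(y₀(z))‖ ≤ ‖∇φ(z)‖ + R`. -/
structure IsAdmissiblePotential {n : ℕ} (φ : EuclideanSpace ℝ (Fin n) → ℝ) : Prop where
  contDiff : ContDiff ℝ 2 φ
  strictConvexOn : StrictConvexOn ℝ Set.univ φ
  superlinear : Tendsto (fun x => φ x / ‖x‖) (cocompact (EuclideanSpace ℝ (Fin n))) atTop
  isProbabilityMeasure : IsProbabilityMeasure (potentialMeasure φ)
  moment : ∀ R : ℝ, 0 < R →
    ∀ y₀ : EuclideanSpace ℝ (Fin n) → EuclideanSpace ℝ (Fin n), Measurable y₀ →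
      (∀ z, ‖∇ φ (y₀ z)‖ ≤ ‖∇ φ z‖ + R) →
      ∫⁻ z, (‖z‖ₑ + ‖y₀ z‖ₑ + ENNReal.ofReal R) ^ 2 *
          (‖∇ φ z‖ₑ + ⨆ y ∈ {y : EuclideanSpace ℝ (Fin n) | ‖y - z + y₀ z‖ ≤ R},
            ‖hessian φ y‖ₑ) ∂(potentialMeasure φ) < ⊤

/-- `g` is regular enough for the inequality with parameter `lam`: it is `C¹` and the three
integrals occurring in the inequality exist and are finite. -/
structure IsAdmissibleFunction {n : ℕ} (φ : EuclideanSpace ℝ (Fin n) → ℝ) (lam : ℝ)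
    (g : EuclideanSpace ℝ (Fin n) → ℝ) : Prop where
  contDiff : ContDiff ℝ 1 g
  integrable_exp : Integrable (fun x => Real.exp (g x)) volume
  integrable_mul_exp : Integrable (fun x => g x * Real.exp (g x)) volume
  integrable_fenchel : Integrable
    (fun x => fenchelLegendre φ (-(lam • ∇ g x)) * Real.exp (g x)) volume

end

noncomputable section

open ProbabilityTheory Set
open scoped ENNReal

/-! The inequality is proved by mass transport. Let `T` be the Knothe map carrying `e^g / ∫ e^g` to
the normalized restriction of `e^{-φ}` to the cube `[-R, R]ⁿ`. It is triangular and monotone in each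
coordinate, so its Jacobian is the product of the densities `h i` of the diagonal derivatives: `e^g
N = e^{-φ(T)} M ∏ h i` a.e., with `M = ∫ e^g` and `N` the mass of the cube (`exists_knothe`).

Take logarithms. The bound `log h ≤ lam * h - 1 - log lam` replaces the Jacobian by a divergence and
produces `-n log (lam e)`. Fenchel-Young at `T x` bounds `-φ(T) - lam ∇g · T` by `φ*(-lam ∇g)`. What
remains is `lam (T · ∇(e^g) + e^g ∑ h i)`, whose integral vanishes by integration by parts
(`integral_density_mul_eq_neg_pi`). The cube makes `T` bounded, so no growth condition on `T` is
needed; letting `R → ∞` sends `log N` to `0`.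

For `g = -φ(· - xbar)`, convexity makes Fenchel-Young an equality at the gradient, and `∫ ∇φ(z) · z
e^{-φ} = n` balances the constant `-n`. -/

/-! ### Monotone rearrangement on the line. -/

lemma ProbabilityTheory.continuous_cdf (μ : Measure ℝ) [IsProbabilityMeasure μ] [NullSingletonClass μ] :
    Continuous (cdf μ) := by
  rw [continuous_iff_continuousAt]
  intro x
  rw [(monotone_cdf μ).continuousAt_iff_leftLim_eq_rightLim, StieltjesFunction.rightLim_eq]
  have h := (cdf μ).measure_singleton x
  rw [measure_cdf, measure_singleton, eq_comm, ENNReal.ofReal_eq_zero] at h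
  exact le_antisymm ((monotone_cdf μ).leftLim_le le_rfl) (by linarith)

/-- The monotone rearrangement of `μ` onto `ν`. -/
def monotoneRearrangement (μ ν : Measure ℝ) (s : ℝ) : ℝ :=
  sInf {u | μ (Iic s) ≤ ν (Iic u)}

section rearrangement

variable {μ ν : Measure ℝ} [IsProbabilityMeasure μ] [IsProbabilityMeasure ν] {a b : ℝ}

/-- Right-continuity of the cdf of `ν` puts the infimum in the set, which `hμ` and `ha` bound below
and `hb` makes nonempty. The later properties of the rearrangement come from this Galois connection.
-/
lemma monotoneRearrangement_le_iff (hμ : ∀ s, μ (Iic s) ≠ 0) (ha : ν (Iio a) = 0)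
    (hb : ν (Iic b) = 1) {s u : ℝ} :
    monotoneRearrangement μ ν s ≤ u ↔ μ (Iic s) ≤ ν (Iic u) := by
  have hbdd : BddBelow {u | μ (Iic s) ≤ ν (Iic u)} := by
    refine ⟨a, fun u hu => ?_⟩
    by_contra! hlt
    have : ν (Iic u) = 0 := measure_mono_null (Iic_subset_Iio.2 hlt) ha
    simp only [mem_ofPred_eq, this, nonpos_iff_eq_zero] at hu
    exact hμ s hu
  have hne : {u | μ (Iic s) ≤ ν (Iic u)}.Nonempty := ⟨b, by
    simp only [mem_ofPred_eq, hb]; exact prob_le_one⟩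
  refine ⟨fun h => ?_, fun h => csInf_le hbdd h⟩
  have key : ∀ v, u < v → μ (Iic s) ≤ ν (Iic v) := fun v hv => by
    obtain ⟨w, hw, hwv⟩ := exists_lt_of_csInf_lt hne (lt_of_le_of_lt h hv)
    exact hw.trans (measure_mono (Iic_subset_Iic.2 hwv.le))
  have hlim : Tendsto (fun v => ν (Iic v)) (𝓝[>] u) (𝓝 (ν (Iic u))) := by
    simp only [← ofReal_cdf]
    refine ENNReal.tendsto_ofReal ?_
    exact ((cdf ν).right_continuous u).tendsto.mono_left (nhdsWithin_mono _ Ioi_subset_Ici_self)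
  exact ge_of_tendsto hlim (eventually_nhdsWithin_of_forall key)

lemma monotoneRearrangement_mem_Icc (hμ : ∀ s, μ (Iic s) ≠ 0) (ha : ν (Iio a) = 0)
    (hb : ν (Iic b) = 1) (s : ℝ) : monotoneRearrangement μ ν s ∈ Icc a b := by
  refine ⟨?_, (monotoneRearrangement_le_iff hμ ha hb).2 (hb ▸ prob_le_one)⟩
  by_contra! hlt
  have := (monotoneRearrangement_le_iff hμ ha hb).1 (le_refl (monotoneRearrangement μ ν s))
  rw [measure_mono_null (Iic_subset_Iio.2 hlt) ha] at this
  exact hμ s (nonpos_iff_eq_zero.1 this)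

lemma measure_Iic_monotoneRearrangement [NullSingletonClass ν] (hμ : ∀ s, μ (Iic s) ≠ 0)
    (ha : ν (Iio a) = 0) (hb : ν (Iic b) = 1) (s : ℝ) :
    ν (Iic (monotoneRearrangement μ ν s)) = μ (Iic s) := by
  refine le_antisymm ?_ ((monotoneRearrangement_le_iff hμ ha hb).1 le_rfl)
  have key : ∀ v, v < monotoneRearrangement μ ν s → ν (Iic v) ≤ μ (Iic s) := fun v hv => by
    by_contra! h
    exact absurd ((monotoneRearrangement_le_iff hμ ha hb).2 h.le) (not_le.2 hv)
  have hlim : Tendsto (fun v => ν (Iic v)) (𝓝[<] (monotoneRearrangement μ ν s))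
      (𝓝 (ν (Iic (monotoneRearrangement μ ν s)))) := by
    simp only [← ofReal_cdf]
    exact ENNReal.tendsto_ofReal
      ((continuous_cdf ν).continuousAt.tendsto.mono_left nhdsWithin_le_nhds)
  exact le_of_tendsto hlim (eventually_nhdsWithin_of_forall key)

lemma monotone_monotoneRearrangement (hμ : ∀ s, μ (Iic s) ≠ 0) (ha : ν (Iio a) = 0)
    (hb : ν (Iic b) = 1) : Monotone (monotoneRearrangement μ ν) := fun _ _ hst =>
  (monotoneRearrangement_le_iff hμ ha hb).2 <| (measure_mono (Iic_subset_Iic.2 hst)).trans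
    ((monotoneRearrangement_le_iff hμ ha hb).1 le_rfl)

/-- The preimage of `Iic u` is a sublevel set of the cdf of `μ`. By the intermediate value theorem
and strict monotonicity it is a half-line `Iic s₀` with the right mass; the levels `0` and `1`,
which that cdf does not attain, are treated apart. -/
lemma map_monotoneRearrangement [NullSingletonClass μ] (hμ : ∀ s t, s < t → μ (Iic s) < μ (Iic t))
    (ha : ν (Iio a) = 0) (hb : ν (Iic b) = 1) : μ.map (monotoneRearrangement μ ν) = ν := by
  have hμ0 : ∀ s, μ (Iic s) ≠ 0 := fun s => (zero_le.trans_lt (hμ (s - 1) s (by simp))).ne'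
  have hmeas := (monotone_monotoneRearrangement hμ0 ha hb).measurable
  have : IsProbabilityMeasure (μ.map (monotoneRearrangement μ ν)) :=
    Measure.isProbabilityMeasure_map hmeas.aemeasurable
  refine Measure.ext_of_Iic _ _ fun u => ?_
  rw [Measure.map_apply hmeas measurableSet_Iic]
  have hset : monotoneRearrangement μ ν ⁻¹' Iic u = {s | μ (Iic s) ≤ ν (Iic u)} := by
    ext s; exact monotoneRearrangement_le_iff hμ0 ha hb
  rw [hset]
  rcases eq_or_ne (ν (Iic u)) 0 with h0 | h0
  · simp [h0, hμ0]
  rcases eq_or_ne (ν (Iic u)) 1 with h1 | h1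
  · simp [h1, prob_le_one]
  have hp0 : 0 < cdf ν u := by
    rw [cdf_eq_real]; exact ENNReal.toReal_pos h0 (measure_ne_top _ _)
  have hp1 : cdf ν u < 1 := by
    refine lt_of_le_of_ne (cdf_le_one ν u) fun h => h1 ?_
    rw [← ofReal_cdf, h, ENNReal.ofReal_one]
  obtain ⟨s₀, hs₀⟩ : cdf ν u ∈ range (cdf μ) := by
    refine mem_range_of_exists_le_of_exists_ge (continuous_cdf μ) ?_ ?_
    · exact (((tendsto_cdf_atBot μ).eventually (gt_mem_nhds hp0)).exists).imp fun _ h => h.le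
    · exact (((tendsto_cdf_atTop μ).eventually (lt_mem_nhds hp1)).exists).imp fun _ h => h.le
  have hs : ν (Iic u) = μ (Iic s₀) := by rw [← ofReal_cdf, ← ofReal_cdf, hs₀]
  have : {s | μ (Iic s) ≤ ν (Iic u)} = Iic s₀ := by
    ext s
    rw [mem_ofPred_eq, hs, mem_Iic]
    refine ⟨fun h => ?_, fun h => measure_mono (Iic_subset_Iic.2 h)⟩
    by_contra! hlt
    exact absurd (hμ _ _ hlt) (not_lt.2 h)
  rw [this, hs]

/-- The rearrangement is strictly increasing here, so `Iic t` is exactly the preimage of `Iic (T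
t)`; the rest is change of variables. -/
lemma setLIntegral_comp_monotoneRearrangement [NullSingletonClass μ] [NullSingletonClass ν]
    (hμ : ∀ s t, s < t → μ (Iic s) < μ (Iic t))
    (ha : ν (Iio a) = 0) (hb : ν (Iic b) = 1) {φ : ℝ → ℝ≥0∞} (hφ : Measurable φ) (t : ℝ) :
    ∫⁻ s in Iic t, φ (monotoneRearrangement μ ν s) ∂μ =
      ∫⁻ u in Iic (monotoneRearrangement μ ν t), φ u ∂ν := by
  have hμ0 : ∀ s, μ (Iic s) ≠ 0 := fun s => (zero_le.trans_lt (hμ (s - 1) s (by simp))).ne'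
  have hmeas := (monotone_monotoneRearrangement hμ0 ha hb).measurable
  conv_rhs => rw [← map_monotoneRearrangement hμ ha hb (ν := ν)]
  rw [setLIntegral_map measurableSet_Iic hφ hmeas, map_monotoneRearrangement hμ ha hb]
  congr 2
  ext s
  rw [mem_preimage, mem_Iic, mem_Iic, monotoneRearrangement_le_iff hμ0 ha hb,
    measure_Iic_monotoneRearrangement hμ0 ha hb]
  refine ⟨fun h => measure_mono (Iic_subset_Iic.2 h), fun h => ?_⟩
  by_contra! hlt
  exact absurd (hμ _ _ hlt) (not_lt.2 h)

end rearrangement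

/-- For densities `f` and `ρ`, the rearrangement `T` of `f` onto `ρ|_[-R,R]` has
`h = f / ρ ∘ T` (after normalization) as its derivative. -/
lemma monotoneRearrangement_withDensity {R : ℝ} (hR : 0 < R) {f ρ : ℝ → ℝ≥0∞}
    (hf : Measurable f) (hf0 : ∀ s, f s ≠ 0) (hM : ∫⁻ s, f s ≠ ∞) (hρ : Measurable ρ)
    (hρ0 : ∀ u, ρ u ≠ 0) (hρtop : ∀ u, ρ u ≠ ∞) (hN : ∫⁻ u in Icc (-R) R, ρ u ≠ ∞)
    {T : ℝ → ℝ}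
    (hT : ∀ s, T s = sInf {u | (∫⁻ x in Iic s, f x) / ∫⁻ x, f x ≤
      (∫⁻ x in Icc (-R) R ∩ Iic u, ρ x) / ∫⁻ x in Icc (-R) R, ρ x}) :
    (∀ s u, T s ≤ u ↔ (∫⁻ x in Iic s, f x) / ∫⁻ x, f x ≤
      (∫⁻ x in Icc (-R) R ∩ Iic u, ρ x) / ∫⁻ x in Icc (-R) R, ρ x) ∧
    (∀ s, T s ∈ Icc (-R) R) ∧
    ∀ t, ∫⁻ s in Iic t, f s * (∫⁻ u in Icc (-R) R, ρ u) / (ρ (T s) * ∫⁻ s, f s) =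
      ENNReal.ofReal (T t + R) := by
  have hfs : Function.support f = univ := by ext s; simp [hf0 s]
  have hρs : Function.support ρ = univ := by ext s; simp [hρ0 s]
  have hM0 : ∫⁻ s, f s ≠ 0 := by
    rw [← setLIntegral_univ]
    exact ((setLIntegral_pos_iff hf).2 (by simp [hfs])).ne'
  have hN0 : ∫⁻ u in Icc (-R) R, ρ u ≠ 0 := by
    refine ((setLIntegral_pos_iff hρ).2 ?_).ne'
    simp [hρs, hR]
  set M := ∫⁻ s, f s with hMdef
  set N := ∫⁻ u in Icc (-R) R, ρ u with hNdef
  let μ : Measure ℝ := M⁻¹ • volume.withDensity f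
  let ν : Measure ℝ := N⁻¹ • (volume.restrict (Icc (-R) R)).withDensity ρ
  have hμa : ∀ s, MeasurableSet s → μ s = (∫⁻ x in s, f x) / M := fun s hs => by
    simp [μ, withDensity_apply _ hs, ENNReal.div_eq_inv_mul]
  have hνa : ∀ s, MeasurableSet s → ν s = (∫⁻ x in Icc (-R) R ∩ s, ρ x) / N := fun s hs => by
    simp [ν, withDensity_apply _ hs, ENNReal.div_eq_inv_mul, Measure.restrict_restrict hs,
      inter_comm]
  have : IsProbabilityMeasure μ := ⟨by
    rw [hμa _ .univ, setLIntegral_univ, ENNReal.div_self hM0 hM]⟩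
  have : IsProbabilityMeasure ν := ⟨by
    rw [hνa _ .univ, inter_univ, ENNReal.div_self hN0 hN]⟩
  have : NullSingletonClass μ := ⟨fun x => by rw [hμa _ (measurableSet_singleton x)]; simp⟩
  have : NullSingletonClass ν := ⟨fun x => by
    rw [hνa _ (measurableSet_singleton x), Measure.restrict_eq_zero.2]
    · simp
    · exact measure_mono_null inter_subset_right (by simp)⟩
  have hμ : ∀ s t, s < t → μ (Iic s) < μ (Iic t) := fun s t hst => by
    rw [← Iic_union_Ioc_eq_Iic hst.le, measure_union (by
      rw [disjoint_left]; intro x hx hx'; exact not_lt.2 hx hx'.1) measurableSet_Ioc]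
    refine ENNReal.lt_add_right (measure_ne_top _ _) ?_
    rw [hμa _ measurableSet_Ioc]
    refine (ENNReal.div_pos ?_ hM).ne'
    exact ((setLIntegral_pos_iff hf).2 (by simp [hfs, hst])).ne'
  have hμ0 : ∀ s, μ (Iic s) ≠ 0 := fun s => (zero_le.trans_lt (hμ (s - 1) s (by simp))).ne'
  have ha : ν (Iio (-R)) = 0 := by
    rw [hνa _ measurableSet_Iio]
    have : Icc (-R) R ∩ Iio (-R) = ∅ := by
      ext x; simp only [mem_inter_iff, mem_Icc, mem_Iio, mem_empty_iff_false, iff_false]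
      intro h; linarith [h.1.1, h.2]
    simp [this]
  have hb : ν (Iic R) = 1 := by
    rw [hνa _ measurableSet_Iic]
    have : Icc (-R) R ∩ Iic R = Icc (-R) R := inter_eq_left.2 fun x hx => hx.2
    rw [this, ENNReal.div_self hN0 hN]
  have hTm : T = monotoneRearrangement μ ν := by
    funext s
    rw [hT, monotoneRearrangement]
    simp only [hμa _ measurableSet_Iic, hνa _ measurableSet_Iic]
  have hTmeas : Measurable T := hTm ▸ (monotone_monotoneRearrangement hμ0 ha hb).measurable
  refine ⟨fun s u => ?_, fun s => hTm ▸ monotoneRearrangement_mem_Icc hμ0 ha hb s, fun t => ?_⟩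
  · rw [hTm, monotoneRearrangement_le_iff hμ0 ha hb, hμa _ measurableSet_Iic,
      hνa _ measurableSet_Iic]
  have h1 : ∀ s, f s * N / (ρ (T s) * M) = N * (M⁻¹ * (f s * (ρ (T s))⁻¹)) := fun s => by
    rw [ENNReal.div_eq_inv_mul, ENNReal.mul_inv (Or.inr hM) (Or.inr hM0)]
    ring
  -- The test function `1 / ρ` cancels the density of `ν` and leaves the length of `[-R, T t]`, so
  -- `T` never has to be differentiated.
  have h2 := setLIntegral_comp_monotoneRearrangement hμ ha hb hρ.inv t
  rw [← hTm] at h2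
  simp only [μ, ν, Measure.restrict_smul, lintegral_smul_measure, smul_eq_mul] at h2
  rw [restrict_withDensity measurableSet_Iic, restrict_withDensity measurableSet_Iic,
    lintegral_withDensity_eq_lintegral_mul _ hf (g := fun s => ρ⁻¹ (T s)) (hρ.inv.comp hTmeas),
    lintegral_withDensity_eq_lintegral_mul _ hρ hρ.inv] at h2
  simp only [Pi.mul_apply, Pi.inv_apply,
    ENNReal.mul_inv_cancel (hρ0 _) (hρtop _)] at h2
  simp only [h1]
  have hm : Measurable fun s => f s * (ρ (T s))⁻¹ := hf.mul (hρ.inv.comp hTmeas)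
  rw [lintegral_const_mul _ (hm.const_mul _), lintegral_const_mul _ hm, h2, ← mul_assoc,
    ENNReal.mul_inv_cancel hN0 hN, one_mul, lintegral_one, Measure.restrict_apply_univ,
    Measure.restrict_apply measurableSet_Iic]
  have hTt : T t ≤ R := (hTm ▸ monotoneRearrangement_mem_Icc hμ0 ha hb t : T t ∈ Icc (-R) R).2
  have : Iic (T t) ∩ Icc (-R) R = Icc (-R) (T t) := by
    ext x; simp only [mem_inter_iff, mem_Iic, mem_Icc]
    constructor
    · rintro ⟨h, h', -⟩; exact ⟨h', h⟩
    · rintro ⟨h, h'⟩; exact ⟨h', h, h'.trans hTt⟩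
  rw [this, Real.volume_Icc, sub_neg_eq_add]

/-- Joint measurability is what allows iteration, where `ω` will contain the earlier coordinates. It
holds because the Galois connection turns `T ω s ≤ u` into a comparison of measurable functions. -/
lemma exists_measurable_transport {Ω : Type*} [MeasurableSpace Ω] {R : ℝ} (hR : 0 < R)
    {f ρ : Ω → ℝ → ℝ≥0∞} (hf : Measurable (Function.uncurry f)) (hf0 : ∀ ω s, f ω s ≠ 0)
    (hρ : Measurable (Function.uncurry ρ)) (hρ0 : ∀ ω u, ρ ω u ≠ 0) (hρtop : ∀ ω u, ρ ω u ≠ ∞)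
    (hN : ∀ ω, ∫⁻ u in Icc (-R) R, ρ ω u ≠ ∞) :
    ∃ (T : Ω → ℝ → ℝ) (h : Ω → ℝ → ℝ≥0∞), Measurable (Function.uncurry T) ∧
      Measurable (Function.uncurry h) ∧ (∀ ω s, T ω s ∈ Icc (-R) R) ∧
      (∀ ω t, ∫⁻ s in Iic t, h ω s = ENNReal.ofReal (T ω t + R)) ∧
      ∀ ω s, ∫⁻ s, f ω s ≠ ∞ →
        f ω s * ∫⁻ u in Icc (-R) R, ρ ω u = ρ ω (T ω s) * (∫⁻ s, f ω s) * h ω s := by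
  classical
  let M : Ω → ℝ≥0∞ := fun ω => ∫⁻ s, f ω s
  let N : Ω → ℝ≥0∞ := fun ω => ∫⁻ u in Icc (-R) R, ρ ω u
  have hMm : Measurable M := hf.lintegral_prod_right'
  have hNm : Measurable N := hρ.lintegral_prod_right'
  have hF : Measurable fun p : Ω × ℝ => (∫⁻ x in Iic p.2, f p.1 x) / M p.1 := by
    refine Measurable.div ?_ (hMm.comp measurable_fst)
    have : ∀ p : Ω × ℝ, ∫⁻ x in Iic p.2, f p.1 x =
        ∫⁻ x, {q : (Ω × ℝ) × ℝ | q.2 ≤ q.1.2}.indicator (fun q => f q.1.1 q.2) (p, x) := by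
      intro p
      rw [← lintegral_indicator measurableSet_Iic]
      rfl
    simp only [this]
    refine Measurable.lintegral_prod_right' (f := {q : (Ω × ℝ) × ℝ | q.2 ≤ q.1.2}.indicator
      (fun q => f q.1.1 q.2)) (Measurable.indicator ?_ ?_)
    · exact hf.comp (measurable_fst.fst.prodMk measurable_snd)
    · exact measurableSet_le measurable_snd measurable_fst.snd
  -- On fibres of infinite mass, the constant `-R` with density `0` keeps the integral identity
  -- true.
  let T : Ω → ℝ → ℝ := fun ω s => if M ω = ∞ then -R else
    sInf {u | (∫⁻ x in Iic s, f ω x) / M ω ≤ (∫⁻ x in Icc (-R) R ∩ Iic u, ρ ω x) / N ω}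
  have key : ∀ ω, M ω ≠ ∞ → _ := fun ω hω => monotoneRearrangement_withDensity hR
    (f := f ω) (ρ := ρ ω) (T := T ω) (hf.comp measurable_prodMk_left) (hf0 ω) hω
    (hρ.comp measurable_prodMk_left) (hρ0 ω) (hρtop ω) (hN ω) (fun s => if_neg hω)
  have hMset : MeasurableSet {p : Ω × ℝ | M p.1 = ∞} :=
    hMm.comp measurable_fst (measurableSet_singleton _)
  have hTm : Measurable (Function.uncurry T) := by
    refine measurable_of_Iic fun u => ?_
    have : Function.uncurry T ⁻¹' Iic u = ({p : Ω × ℝ | M p.1 = ∞} ∩ {_p | -R ≤ u}) ∪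
        ({p : Ω × ℝ | M p.1 = ∞}ᶜ ∩ {p | (∫⁻ x in Iic p.2, f p.1 x) / M p.1 ≤
          (∫⁻ x in Icc (-R) R ∩ Iic u, ρ p.1 x) / N p.1}) := by
      ext ⟨ω, s⟩
      by_cases hω : M ω = ∞
      · simp [hω, T, Function.uncurry]
      · have := (key ω hω).1 s u
        simp only [Function.uncurry, mem_preimage, mem_Iic, mem_union, mem_inter_iff,
          mem_ofPred_eq, hω, false_and, mem_compl_iff, not_false_eq_true, true_and, false_or]
        exact this
    rw [this]
    refine (hMset.inter (MeasurableSet.const _)).union (hMset.compl.inter ?_)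
    refine measurableSet_le hF ?_
    refine Measurable.div (Measurable.comp (g := fun ω => ∫⁻ x in Icc (-R) R ∩ Iic u, ρ ω x) ?_
      measurable_fst) (hNm.comp measurable_fst)
    exact hρ.lintegral_prod_right'
  refine ⟨T, fun ω s => if M ω = ∞ then 0 else f ω s * N ω / (ρ ω (T ω s) * M ω), hTm, ?_, ?_,
    ?_, ?_⟩
  · refine Measurable.ite hMset measurable_const ?_
    refine (hf.mul (hNm.comp measurable_fst)).div (Measurable.mul ?_ (hMm.comp measurable_fst))
    exact hρ.comp (measurable_fst.prodMk hTm)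
  · intro ω s
    by_cases hω : M ω = ∞
    · simp [T, hω, hR.le]
    · exact (key ω hω).2.1 s
  · intro ω t
    by_cases hω : M ω = ∞
    · simp [T, hω]
    · simp only [hω, if_false]
      exact (key ω hω).2.2 t
  · intro ω s hω
    have hω' : M ω ≠ ∞ := hω
    have hM0 : M ω ≠ 0 := by
      have hfs : Function.support (f ω) = univ := by ext s; simp [hf0 ω s]
      have hfm : Measurable (f ω) := hf.comp measurable_prodMk_left
      change ∫⁻ s, f ω s ≠ 0
      rw [← setLIntegral_univ]
      exact ((setLIntegral_pos_iff hfm).2 (by simp [hfs])).ne'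
    simp only [hω', if_false]
    exact (ENNReal.mul_div_cancel (mul_ne_zero (hρ0 _ _) hM0)
      (ENNReal.mul_ne_top (hρtop _ _) hω)).symm

/-! ### The Knothe map onto a cube. -/

lemma lintegral_fin_cons {n : ℕ} {F : (Fin (n + 1) → ℝ) → ℝ≥0∞} (hF : Measurable F) :
    ∫⁻ x, F x = ∫⁻ s, ∫⁻ y : Fin n → ℝ, F (Fin.cons s y) := by
  have h := (volume_preserving_piFinSuccAbove (fun _ : Fin (n + 1) => ℝ) 0).symm
  rw [← h.lintegral_comp hF, Measure.volume_eq_prod, lintegral_prod]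
  · simp [MeasurableEquiv.piFinSuccAbove, Fin.insertNthEquiv]
  · exact (hF.comp h.measurable).aemeasurable

lemma measurable_fin_cons {n : ℕ} :
    Measurable fun p : ℝ × (Fin n → ℝ) => (Fin.cons p.1 p.2 : Fin (n + 1) → ℝ) := by
  refine measurable_pi_iff.2 fun i => ?_
  refine Fin.cases ?_ (fun j => ?_) i
  · simpa using measurable_fst
  · simp only [Fin.cons_succ]
    exact (measurable_pi_apply j).comp measurable_snd

/-- The cube `[-R, R]ⁿ`. -/
def cube (n : ℕ) (R : ℝ) : Set (Fin n → ℝ) := univ.pi fun _ => Icc (-R) R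

lemma measurableSet_cube (n : ℕ) (R : ℝ) : MeasurableSet (cube n R) :=
  MeasurableSet.univ_pi fun _ => measurableSet_Icc

lemma cons_mem_cube {n : ℕ} {R s : ℝ} {y : Fin n → ℝ} :
    (Fin.cons s y : Fin (n + 1) → ℝ) ∈ cube (n + 1) R ↔ s ∈ Icc (-R) R ∧ y ∈ cube n R := by
  simp only [cube, mem_univ_pi, Fin.forall_fin_succ, Fin.cons_zero, Fin.cons_succ]

lemma setLIntegral_cube_succ {n : ℕ} {R : ℝ} {F : (Fin (n + 1) → ℝ) → ℝ≥0∞} (hF : Measurable F) :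
    ∫⁻ x in cube (n + 1) R, F x =
      ∫⁻ s in Icc (-R) R, ∫⁻ y in cube n R, F (Fin.cons s y) := by
  rw [← lintegral_indicator (measurableSet_cube _ _),
    lintegral_fin_cons (hF.indicator (measurableSet_cube _ _)),
    ← lintegral_indicator measurableSet_Icc]
  congr 1 with s
  by_cases hs : s ∈ Icc (-R) R
  · rw [indicator_of_mem hs, ← lintegral_indicator (measurableSet_cube _ _)]
    congr 1 with y
    by_cases hy : y ∈ cube n R
    · rw [indicator_of_mem hy, indicator_of_mem (cons_mem_cube.2 ⟨hs, hy⟩)]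
    · rw [indicator_of_notMem hy, indicator_of_notMem (fun h => hy (cons_mem_cube.1 h).2)]
  · rw [indicator_of_notMem hs]
    simp only [indicator_of_notMem (fun h => hs (cons_mem_cube.1 h).1), lintegral_zero]

lemma volume_cube_ne_top (n : ℕ) (R : ℝ) : volume (cube n R) ≠ ∞ := by
  rw [cube, volume_pi_pi]
  exact ENNReal.prod_ne_top fun i _ => by simp

lemma volume_cube_pos (n : ℕ) {R : ℝ} (hR : 0 < R) : 0 < volume (cube n R) := by
  rw [cube, volume_pi_pi, pos_iff_ne_zero, Finset.prod_ne_zero_iff]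
  intro i _
  simpa using hR

lemma ae_fin_cons {n : ℕ} {p : (Fin (n + 1) → ℝ) → Prop} (hp : MeasurableSet {x | p x})
    (h : ∀ᵐ s : ℝ, ∀ᵐ y : Fin n → ℝ, p (Fin.cons s y)) : ∀ᵐ x, p x := by
  rw [ae_iff, ← compl_ofPred, ← lintegral_indicator_one hp.compl,
    lintegral_fin_cons (measurable_one.indicator hp.compl)]
  refine lintegral_eq_zero_of_ae_eq_zero ?_
  filter_upwards [h] with s hs
  refine lintegral_eq_zero_of_ae_eq_zero ?_
  filter_upwards [hs] with y hy
  exact indicator_of_notMem (not_not.2 hy) _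

/-- The Knothe transport from the densities `f ω` to the densities `ρ ω` on the cube,
measurably in the parameter `ω`, with the diagonal `h` of its Jacobian. -/
theorem exists_knothe {R : ℝ} (hR : 0 < R) (n : ℕ) {Ω : Type} [MeasurableSpace Ω]
    {f ρ : Ω → (Fin n → ℝ) → ℝ≥0∞} (hf : Measurable (Function.uncurry f))
    (hf0 : ∀ ω x, f ω x ≠ 0) (hρ : Measurable (Function.uncurry ρ)) (hρ0 : ∀ ω x, ρ ω x ≠ 0)
    {C : ℝ≥0∞} (hC : C ≠ ∞) (hρC : ∀ ω x, ρ ω x ≤ C) :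
    ∃ (T : Ω → (Fin n → ℝ) → (Fin n → ℝ)) (h : Fin n → Ω → (Fin n → ℝ) → ℝ≥0∞),
      Measurable (Function.uncurry T) ∧ (∀ i, Measurable (Function.uncurry (h i))) ∧
      (∀ ω x, T ω x ∈ cube n R) ∧
      (∀ i ω x t, ∫⁻ s in Iic t, h i ω (Function.update x i s) =
        ENNReal.ofReal (T ω (Function.update x i t) i + R)) ∧
      ∀ ω, ∫⁻ x, f ω x ≠ ∞ → ∀ᵐ x,
        f ω x * ∫⁻ u in cube n R, ρ ω u = ρ ω (T ω x) * (∫⁻ x, f ω x) * ∏ i, h i ω x := by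
  induction n generalizing Ω with
  | zero =>
    refine ⟨fun _ x => x, fun i => i.elim0, measurable_snd, fun i => i.elim0,
      fun ω x => mem_univ_pi.2 fun i => i.elim0, fun i => i.elim0, fun ω _ => ae_of_all _ fun x => ?_⟩
    have h1 : ∀ F : (Fin 0 → ℝ) → ℝ≥0∞, ∫⁻ x, F x = F x := fun F => by
      rw [lintegral_unique, Measure.volume_pi_eq_dirac x, measure_univ, mul_one]
      exact congrArg F (Subsingleton.elim _ _)
    have h2 : cube 0 R = univ := eq_univ_of_forall fun x => mem_univ_pi.2 fun i => i.elim0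
    rw [h2, setLIntegral_univ, h1, h1]
    simp [mul_comm]
  | succ n ih =>
    -- First-coordinate marginals of source and target; these are matched by the one-dimensional
    -- transport.
    let f₁ : Ω → ℝ → ℝ≥0∞ := fun ω s => ∫⁻ y : Fin n → ℝ, f ω (Fin.cons s y)
    let ρ₁ : Ω → ℝ → ℝ≥0∞ := fun ω s => ∫⁻ y in cube n R, ρ ω (Fin.cons s y)
    have hcons : Measurable fun p : (Ω × ℝ) × (Fin n → ℝ) =>
        (p.1.1, (Fin.cons p.1.2 p.2 : Fin (n + 1) → ℝ)) :=
      measurable_fst.fst.prodMk (measurable_fin_cons.comp (measurable_fst.snd.prodMk measurable_snd))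
    have hf₁ : Measurable (Function.uncurry f₁) := (hf.comp hcons).lintegral_prod_right'
    have hρ₁ : Measurable (Function.uncurry ρ₁) := (hρ.comp hcons).lintegral_prod_right'
    have hfm : ∀ ω, Measurable (f ω) := fun ω => hf.comp measurable_prodMk_left
    have hρm : ∀ ω, Measurable (ρ ω) := fun ω => hρ.comp measurable_prodMk_left
    have hfm' : ∀ ω s, Measurable fun y : Fin n → ℝ => f ω (Fin.cons s y) := fun ω s =>
      (hfm ω).comp (measurable_fin_cons.comp measurable_prodMk_left)
    have hρm' : ∀ ω s, Measurable fun y : Fin n → ℝ => ρ ω (Fin.cons s y) := fun ω s =>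
      (hρm ω).comp (measurable_fin_cons.comp measurable_prodMk_left)
    have hf₁0 : ∀ ω s, f₁ ω s ≠ 0 := fun ω s h0 => by
      have := (lintegral_eq_zero_iff (hfm' ω s)).1 h0
      obtain ⟨y, hy⟩ := this.exists
      exact hf0 _ _ hy
    have hρ₁0 : ∀ ω s, ρ₁ ω s ≠ 0 := fun ω s => by
      refine ((setLIntegral_pos_iff (hρm' ω s)).2 ?_).ne'
      rw [(by ext y; simp [hρ0] : (Function.support fun y : Fin n → ℝ => ρ ω (Fin.cons s y)) = univ),
        univ_inter]
      exact volume_cube_pos n hR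
    have hρ₁le : ∀ ω s, ρ₁ ω s ≤ C * volume (cube n R) := fun ω s =>
      (setLIntegral_mono measurable_const fun y _ => hρC _ _).trans (setLIntegral_const _ _).le
    have hCtop : C * volume (cube n R) ≠ ∞ := ENNReal.mul_ne_top hC (volume_cube_ne_top _ _)
    have hρ₁top : ∀ ω s, ρ₁ ω s ≠ ∞ := fun ω s => ne_top_of_le_ne_top hCtop (hρ₁le ω s)
    have hN₁ : ∀ ω, ∫⁻ u in Icc (-R) R, ρ₁ ω u ≠ ∞ := fun ω =>
      ne_top_of_le_ne_top (ENNReal.mul_ne_top hCtop (by simp))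
        ((setLIntegral_mono measurable_const fun y _ => hρ₁le _ _).trans (setLIntegral_const _ _).le)
    obtain ⟨T₁, h₁, hT₁m, hh₁m, hT₁, hT₁h₁, hid₁⟩ :=
      exists_measurable_transport hR hf₁ hf₁0 hρ₁ hρ₁0 hρ₁top hN₁
    -- The first coordinate `s` joins the parameter: the slice of `f` at `s` is sent to the slice of
    -- `ρ` at `T₁ s`.
    obtain ⟨T', h', hT'm, hh'm, hT', hT'h', hid'⟩ := ih (Ω := Ω × ℝ)
      (f := fun p y => f p.1 (Fin.cons p.2 y))
      (ρ := fun p y => ρ p.1 (Fin.cons (T₁ p.1 p.2) y)) (hf.comp hcons) (fun _ _ => hf0 _ _)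
      ((hρ.comp hcons).comp ((measurable_fst.fst.prodMk (hT₁m.comp measurable_fst)).prodMk
        measurable_snd)) (fun _ _ => hρ0 _ _) (fun _ _ => hρC _ _)
    have hsplit : Measurable fun p : Ω × (Fin (n + 1) → ℝ) => ((p.1, p.2 0), Fin.tail p.2) :=
      (measurable_fst.prodMk ((measurable_pi_apply 0).comp measurable_snd)).prodMk
        (measurable_pi_iff.2 fun j => (measurable_pi_apply j.succ).comp measurable_snd)
    let T : Ω → (Fin (n + 1) → ℝ) → (Fin (n + 1) → ℝ) := fun ω x =>
      Fin.cons (T₁ ω (x 0)) (T' (ω, x 0) (Fin.tail x))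
    let h : Fin (n + 1) → Ω → (Fin (n + 1) → ℝ) → ℝ≥0∞ := fun i ω x =>
      Fin.cases (h₁ ω (x 0)) (fun j => h' j (ω, x 0) (Fin.tail x)) i
    have hTm : Measurable (Function.uncurry T) :=
      measurable_fin_cons.comp ((hT₁m.comp (measurable_fst.comp hsplit)).prodMk (hT'm.comp hsplit))
    have hhm : ∀ i, Measurable (Function.uncurry (h i)) := fun i => by
      refine Fin.cases ?_ (fun j => ?_) i
      · exact hh₁m.comp (measurable_fst.comp hsplit)
      · exact (hh'm j).comp hsplit
    refine ⟨T, h, hTm, hhm, fun ω x => cons_mem_cube.2 ⟨hT₁ _ _, hT' _ _⟩, fun i ω x t => ?_,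
      fun ω hω => ?_⟩
    · refine Fin.cases ?_ (fun j => ?_) i
      · simpa [T, h] using hT₁h₁ ω t
      · have := hT'h' j (ω, x 0) (Fin.tail x) t
        have h0 : ∀ r, Function.update x j.succ r 0 = x 0 := fun r =>
          Function.update_of_ne (Fin.succ_ne_zero j).symm _ _
        simpa [T, h, Fin.tail_update_succ, h0] using this
    · have hM : ∫⁻ x, f ω x = ∫⁻ s, f₁ ω s := lintegral_fin_cons (hfm ω)
      have hN : ∫⁻ u in cube (n + 1) R, ρ ω u = ∫⁻ u in Icc (-R) R, ρ₁ ω u :=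
        setLIntegral_cube_succ (hρm ω)
      have hfin : ∀ᵐ s, f₁ ω s < ∞ :=
        ae_lt_top (hf₁.comp measurable_prodMk_left) (hM ▸ hω)
      refine ae_fin_cons ?_ ?_
      · refine measurableSet_eq_fun ((hfm ω).mul_const _) (Measurable.mul (Measurable.mul_const
          ((hρm ω).comp (hTm.comp measurable_prodMk_left)) _) ?_)
        exact Finset.measurable_prod _ fun i _ => (hhm i).comp measurable_prodMk_left
      filter_upwards [hfin] with s hs
      filter_upwards [hid' (ω, s) hs.ne] with y hy
      have e1 := hid₁ ω s (hM ▸ hω)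
      change f ω (Fin.cons s y) * ρ₁ ω (T₁ ω s) =
        ρ ω (Fin.cons (T₁ ω s) (T' (ω, s) y)) * f₁ ω s * ∏ i, h' i (ω, s) y at hy
      rw [hM, hN, Fin.prod_univ_succ]
      change _ = ρ ω (Fin.cons (T₁ ω s) (T' (ω, s) y)) * _ * (h₁ ω s * ∏ i, h' i (ω, s) y)
      -- The slice mass `ρ₁ (T₁ s)` occurs in both the one-dimensional and the slice identity, and
      -- cancels.
      rw [← ENNReal.mul_left_inj (hρ₁0 ω (T₁ ω s)) (hρ₁top ω (T₁ ω s))]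
      calc f ω (Fin.cons s y) * (∫⁻ u in Icc (-R) R, ρ₁ ω u) * ρ₁ ω (T₁ ω s)
          = (f ω (Fin.cons s y) * ρ₁ ω (T₁ ω s)) * (∫⁻ u in Icc (-R) R, ρ₁ ω u) := by ring
        _ = ρ ω (Fin.cons (T₁ ω s) (T' (ω, s) y)) * (∏ i, h' i (ω, s) y) *
            (f₁ ω s * ∫⁻ u in Icc (-R) R, ρ₁ ω u) := by rw [hy]; ring
        _ = _ := by rw [e1]; ring

/-! ### Integration by parts against the densities of the transport. -/

/-- Integration by parts on the line, `T` having the weak derivative `h ≥ 0`. -/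
lemma integral_density_mul_eq_neg {R : ℝ} {h : ℝ → ℝ≥0∞} (hh : Measurable h) {T : ℝ → ℝ}
    (hT : Measurable T) (hTR : ∀ t, T t ∈ Icc (-R) R)
    (hTh : ∀ t, ∫⁻ s in Iic t, h s = ENNReal.ofReal (T t + R)) {f f' : ℝ → ℝ}
    (hf : ∀ t, HasDerivAt f (f' t) t) (hfi : Integrable f) (hf'i : Integrable f') :
    Integrable (fun s => (h s).toReal * f s) ∧
      ∫ s, ‖(h s).toReal * f s‖ ≤ 2 * R * ∫ t, ‖f' t‖ ∧
      ∫ s, (h s).toReal * f s = -∫ t, T t * f' t := by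
  have hR : 0 ≤ R := by have := hTR 0; linarith [this.1, this.2]
  have htot : ∫⁻ s, h s ≤ ENNReal.ofReal (2 * R) := by
    have h1 := tendsto_measure_Iic_atTop (volume.withDensity h)
    rw [withDensity_apply _ .univ, setLIntegral_univ] at h1
    refine le_of_tendsto h1 (Eventually.of_forall fun t => ?_)
    rw [withDensity_apply _ measurableSet_Iic, hTh]
    exact ENNReal.ofReal_le_ofReal (by linarith [(hTR t).2])
  have hfin : ∫⁻ s, h s ≠ ∞ := ne_top_of_le_ne_top ENNReal.ofReal_ne_top htot
  have hhi : Integrable fun s => (h s).toReal := integrable_toReal_of_lintegral_ne_top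
    hh.aemeasurable hfin
  have hhtot : ∫ s, (h s).toReal ≤ 2 * R := by
    rw [integral_toReal hh.aemeasurable (ae_lt_top hh hfin)]
    exact ENNReal.toReal_le_of_le_ofReal (by positivity) htot
  have hhT : ∀ t, ∫ s in Iic t, (h s).toReal = T t + R := fun t => by
    rw [integral_toReal hh.aemeasurable (ae_restrict_of_ae (ae_lt_top hh hfin)), hTh,
      ENNReal.toReal_ofReal (by linarith [(hTR t).1])]
  have hftail : ∀ s, ∫ t in Ici s, f' t = -f s := fun s => by
    rw [integral_Ici_eq_integral_Ioi, integral_Ioi_of_hasDerivAt_of_tendsto (m := 0)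
      (hf s).continuousAt.continuousWithinAt (fun x _ => hf x) hf'i.integrableOn
      (tendsto_zero_of_hasDerivAt_of_integrableOn_Ioi (a := s) (fun x _ => hf x)
        hf'i.integrableOn hfi.integrableOn), zero_sub]
  have hfbd : ∀ s, ‖f s‖ ≤ ∫ t, ‖f' t‖ := fun s => by
    rw [← norm_neg, ← hftail]
    exact (norm_integral_le_integral_norm _).trans
      (setIntegral_le_integral hf'i.norm (ae_of_all _ fun _ => norm_nonneg _))
  -- Fubini for `h(s) f'(t)` on `s ≤ t`: integrating in `t` first gives `-h f`, in `s` first gives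
  -- `(T + R) f'`. The constant `R` drops out because `∫ f' = 0`.
  have hG : Integrable ({p : ℝ × ℝ | p.1 ≤ p.2}.indicator
      fun p => (h p.1).toReal * f' p.2) (volume.prod volume) :=
    (hhi.mul_prod hf'i).indicator (measurableSet_le measurable_fst measurable_snd)
  have hin1 : ∀ s, ∫ t, {p : ℝ × ℝ | p.1 ≤ p.2}.indicator
      (fun p => (h p.1).toReal * f' p.2) (s, t) = -((h s).toReal * f s) := fun s => by
    rw [← mul_neg, ← hftail, ← integral_const_mul, ← integral_indicator measurableSet_Ici]
    rfl
  have hin2 : ∀ t, ∫ s, {p : ℝ × ℝ | p.1 ≤ p.2}.indicator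
      (fun p => (h p.1).toReal * f' p.2) (s, t) = (T t + R) * f' t := fun t => by
    rw [← hhT, ← integral_mul_const, ← integral_indicator measurableSet_Iic]
    rfl
  have hint : Integrable fun s => (h s).toReal * f s := by
    have := hG.integral_prod_left
    simp only [hin1] at this
    simpa using this.neg
  refine ⟨hint, ?_, ?_⟩
  · calc ∫ s, ‖(h s).toReal * f s‖ ≤ ∫ s, (h s).toReal * ∫ t, ‖f' t‖ := by
          refine integral_mono hint.norm (hhi.mul_const _) fun s => ?_
          simp only [norm_mul, Real.norm_of_nonneg ENNReal.toReal_nonneg]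
          exact mul_le_mul_of_nonneg_left (hfbd s) ENNReal.toReal_nonneg
      _ = (∫ s, (h s).toReal) * ∫ t, ‖f' t‖ := integral_mul_const _ _
      _ ≤ _ := mul_le_mul_of_nonneg_right hhtot (integral_nonneg fun _ => norm_nonneg _)
  · have hswap := integral_integral_swap (f := fun s t => {p : ℝ × ℝ | p.1 ≤ p.2}.indicator
      (fun p => (h p.1).toReal * f' p.2) (s, t)) hG
    simp only [hin1, hin2] at hswap
    have hTf : Integrable fun t => T t * f' t :=
      hf'i.bdd_mul hT.aestronglyMeasurable (c := R)
        (ae_of_all _ fun t => abs_le.2 (hTR t))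
    rw [integral_neg] at hswap
    simp only [add_mul] at hswap
    rw [integral_add hTf (hf'i.const_mul R), integral_const_mul,
      integral_eq_zero_of_hasDerivAt_of_integrable hf hf'i hfi] at hswap
    linarith

/-- Integration by parts in the `i`-th coordinate. -/
lemma integral_density_mul_eq_neg_pi {n : ℕ} (i : Fin n) {R : ℝ} {h : (Fin n → ℝ) → ℝ≥0∞}
    (hh : Measurable h) {T : (Fin n → ℝ) → ℝ} (hT : Measurable T)
    (hTR : ∀ x, T x ∈ Icc (-R) R)
    (hTh : ∀ x t, ∫⁻ s in Iic t, h (Function.update x i s) =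
      ENNReal.ofReal (T (Function.update x i t) + R)) {F D : (Fin n → ℝ) → ℝ}
    (hF : ∀ x t, HasDerivAt (fun t => F (Function.update x i t)) (D (Function.update x i t)) t)
    (hFi : Integrable F) (hDi : Integrable D) :
    Integrable (fun x => (h x).toReal * F x) ∧
      ∫ x, (h x).toReal * F x = -∫ x, T x * D x := by
  obtain _ | m := n
  · exact i.elim0
  have he := (volume_preserving_piFinSuccAbove (fun _ : Fin (m + 1) => ℝ) i).symm
  set e := (MeasurableEquiv.piFinSuccAbove (fun _ : Fin (m + 1) => ℝ) i).symm with hedef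
  have hemb := e.measurableEmbedding
  have hupd : ∀ s y, e (s, y) = Function.update (e (0, y)) i s := fun s y =>
    (Fin.update_insertNth (α := fun _ => ℝ) i (0 : ℝ) s y).symm
  have hFe := (he.integrable_comp_emb hemb).2 hFi
  have hDe := (he.integrable_comp_emb hemb).2 hDi
  rw [Measure.volume_eq_prod] at hFe hDe
  have key : ∀ᵐ y : Fin m → ℝ, Integrable (fun s => (h (e (s, y))).toReal * F (e (s, y))) ∧
      ∫ s, ‖(h (e (s, y))).toReal * F (e (s, y))‖ ≤ 2 * R * ∫ t, ‖D (e (t, y))‖ ∧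
      ∫ s, (h (e (s, y))).toReal * F (e (s, y)) = -∫ t, T (e (t, y)) * D (e (t, y)) := by
    filter_upwards [hFe.prod_left_ae, hDe.prod_left_ae] with y hFy hDy
    exact integral_density_mul_eq_neg (R := R) (h := fun s => h (e (s, y)))
      (T := fun s => T (e (s, y))) (f := fun s => F (e (s, y))) (f' := fun s => D (e (s, y)))
      (hh.comp (e.measurable.comp measurable_prodMk_right))
      (hT.comp (e.measurable.comp measurable_prodMk_right)) (fun _ => hTR _)
      (fun t => by have := hTh (e (0, y)) t; simp only [← hupd] at this; exact this)
      (fun t => by have := hF (e (0, y)) t; simp only [← hupd] at this; exact this) hFy hDy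
  have hTD : Integrable fun x => T x * D x := hDi.bdd_mul hT.aestronglyMeasurable (c := R)
    (ae_of_all _ fun t => abs_le.2 (hTR t))
  have hTDe := (he.integrable_comp_emb hemb).2 hTD
  have hmeas : AEStronglyMeasurable ((fun x => (h x).toReal * F x) ∘ e)
      (volume.prod volume) :=
    (hh.ennreal_toReal.comp e.measurable).aestronglyMeasurable.mul hFe.1
  have hint : Integrable ((fun x => (h x).toReal * F x) ∘ e) (volume.prod volume) := by
    rw [integrable_prod_iff' hmeas]
    refine ⟨key.mono fun y hy => hy.1, ?_⟩
    -- The quantitative bound `2R ∫ |D|` on each line supplies joint integrability of `h F`, which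
    -- Fubini needs.
    refine Integrable.mono' (hDe.norm.integral_prod_right.const_mul (2 * R)) ?_ ?_
    · exact hmeas.norm.prod_swap.integral_prod_right'
    · filter_upwards [key] with y hy
      rw [Real.norm_of_nonneg (integral_nonneg fun _ => norm_nonneg _)]
      exact hy.2.1
  refine ⟨(he.integrable_comp_emb hemb).1 hint, ?_⟩
  rw [← he.integral_comp hemb, ← he.integral_comp hemb (fun x => T x * D x),
    Measure.volume_eq_prod]
  rw [Measure.volume_eq_prod] at hTDe
  refine (integral_prod_symm _ hint).trans (Eq.trans ?_ (congrArg _ (integral_prod_symm _ hTDe)).symm)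
  rw [← integral_neg]
  exact integral_congr_ae (key.mono fun y hy => hy.2.2)

/-! ### Bounds on the Fenchel-Legendre transform. -/

section fenchel

variable {n : ℕ} {φ : EuclideanSpace ℝ (Fin n) → ℝ}

/-- Superlinearity gives the bound off a compact set, continuity on it. The origin is adjoined
because the quotient there is a division by zero. -/
lemma exists_linear_lower_bound (hc : Continuous φ)
    (hs : Tendsto (fun x => φ x / ‖x‖) (cocompact (EuclideanSpace ℝ (Fin n))) atTop) (K : ℝ) :
    ∃ c, ∀ z, K * ‖z‖ - c ≤ φ z := by
  obtain ⟨t, ht, hsub⟩ := mem_cocompact.1 (hs (eventually_ge_atTop K))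
  obtain ⟨c, hcb⟩ := ((ht.union (isCompact_singleton (x := 0))).image
    ((continuous_const.mul continuous_norm).sub hc : Continuous fun z => K * ‖z‖ - φ z)).bddAbove
  have hc' : ∀ z, z ∈ t ∪ {0} → K * ‖z‖ - φ z ≤ c := fun z hz => hcb (mem_image_of_mem _ hz)
  refine ⟨max c 0, fun z => ?_⟩
  by_cases hz : z ∈ t ∪ {0}
  · linarith [hc' z hz, le_max_left c 0]
  · rw [mem_union, not_or] at hz
    have h1 : K ≤ φ z / ‖z‖ := hsub hz.1
    have h2 : 0 < ‖z‖ := norm_pos_iff.2 hz.2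
    linarith [(le_div_iff₀ h2).1 h1, le_max_right c 0]

lemma bddAbove_fenchelLegendre (hc : Continuous φ)
    (hs : Tendsto (fun x => φ x / ‖x‖) (cocompact (EuclideanSpace ℝ (Fin n))) atTop)
    (x : EuclideanSpace ℝ (Fin n)) : BddAbove (range fun z => inner ℝ x z - φ z) := by
  obtain ⟨c, h⟩ := exists_linear_lower_bound hc hs ‖x‖
  refine ⟨c, ?_⟩
  rintro _ ⟨z, rfl⟩
  have := real_inner_le_norm x z
  have := h z
  dsimp only
  linarith

lemma inner_sub_le_fenchelLegendre (hc : Continuous φ)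
    (hs : Tendsto (fun x => φ x / ‖x‖) (cocompact (EuclideanSpace ℝ (Fin n))) atTop)
    (x z : EuclideanSpace ℝ (Fin n)) : inner ℝ x z - φ z ≤ fenchelLegendre φ x :=
  le_ciSup (bddAbove_fenchelLegendre hc hs x) z

/-- Test the supremum at the unit vector in direction `x`. Through this bound, integrability of
`φ*(-lam ∇g) e^g` controls `∇g e^g`. -/
lemma exists_norm_le_fenchelLegendre (hc : Continuous φ)
    (hs : Tendsto (fun x => φ x / ‖x‖) (cocompact (EuclideanSpace ℝ (Fin n))) atTop) :
    ∃ C, ∀ x, ‖x‖ ≤ fenchelLegendre φ x + C := by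
  obtain ⟨C, hC⟩ := ((isCompact_closedBall (0 : EuclideanSpace ℝ (Fin n)) 1).image hc).bddAbove
  refine ⟨C, fun x => ?_⟩
  have h1 := inner_sub_le_fenchelLegendre hc hs x (‖x‖⁻¹ • x)
  have h2 : φ (‖x‖⁻¹ • x) ≤ C := by
    refine hC (mem_image_of_mem _ ?_)
    rw [mem_closedBall_zero_iff, norm_smul, norm_inv, norm_norm]
    exact inv_mul_le_one
  have h3 : inner ℝ x (‖x‖⁻¹ • x) = ‖x‖ := by
    rw [real_inner_smul_right, real_inner_self_eq_norm_sq]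
    rcases eq_or_ne ‖x‖ 0 with h | h
    · simp [h]
    · field_simp
  linarith

end fenchel

/-! ### The entropy inequality. -/

lemma continuous_gradient {n : ℕ} {g : EuclideanSpace ℝ (Fin n) → ℝ} (hg : ContDiff ℝ 1 g) :
    Continuous (∇ g) :=
  (InnerProductSpace.toDual ℝ _).symm.continuous.comp (hg.continuous_fderiv one_ne_zero)

lemma hasDerivAt_comp_update {n : ℕ} {g : EuclideanSpace ℝ (Fin n) → ℝ} (hg : Differentiable ℝ g)
    (x : Fin n → ℝ) (i : Fin n) (t : ℝ) :
    HasDerivAt (fun t => g (WithLp.toLp 2 (Function.update x i t)))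
      (∇ g (WithLp.toLp 2 (Function.update x i t)) i) t := by
  have h1 := (hg (WithLp.toLp 2 (Function.update x i t))).hasGradientAt.hasFDerivAt
  have h2 := ((PiLp.continuousLinearEquiv 2 ℝ fun _ : Fin n => ℝ).symm.hasFDerivAt
    (x := Function.update x i t)).comp_hasDerivAt t (hasDerivAt_update x i t)
  have h3 := h1.comp_hasDerivAt t h2
  refine h3.congr_deriv ?_
  change inner ℝ (∇ g _) (EuclideanSpace.single i (1 : ℝ)) = _
  rw [EuclideanSpace.inner_single_right, one_mul]
  rfl

lemma log_le_mul_sub {lam : ℝ} (hl : 0 < lam) {a : ℝ} (ha : 0 < a) :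
    Real.log a ≤ lam * a - 1 - Real.log lam := by
  have := Real.log_le_sub_one_of_pos (mul_pos hl ha)
  rw [Real.log_mul hl.ne' ha.ne'] at this
  linarith

lemma entropy_exp_eq {Ω : Type*} [MeasurableSpace Ω] {μ : Measure Ω} {g : Ω → ℝ}
    (h1 : Integrable (fun x => Real.exp (g x)) μ)
    (h2 : Integrable (fun x => g x * Real.exp (g x)) μ) (hpos : 0 < ∫ x, Real.exp (g x) ∂μ) :
    entropy μ (fun x => Real.exp (g x)) = ∫ x, g x * Real.exp (g x) ∂μ -
      Real.log (∫ x, Real.exp (g x) ∂μ) * ∫ x, Real.exp (g x) ∂μ := by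
  rw [entropy, ← integral_const_mul, ← integral_sub h2 (h1.const_mul _)]
  refine integral_congr_ae (ae_of_all _ fun x => ?_)
  simp only
  rw [Real.log_div (Real.exp_pos _).ne' hpos.ne', Real.log_exp]
  ring

lemma lintegral_exp_neg_eq_one {n : ℕ} {φ : EuclideanSpace ℝ (Fin n) → ℝ}
    (hp : IsProbabilityMeasure (potentialMeasure φ)) :
    ∫⁻ x, ENNReal.ofReal (Real.exp (-φ x)) = 1 := by
  have := hp.measure_univ
  rwa [potentialMeasure, withDensity_apply _ .univ, setLIntegral_univ] at this

/-- The entropy bound obtained by transporting onto the restriction of `e^{-φ}` to a cube. -/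
lemma integral_mul_exp_le_of_cube {n : ℕ} {φ : EuclideanSpace ℝ (Fin n) → ℝ}
    (hc : Continuous φ)
    (hs : Tendsto (fun x => φ x / ‖x‖) (cocompact (EuclideanSpace ℝ (Fin n))) atTop)
    (hp : IsProbabilityMeasure (potentialMeasure φ)) {lam : ℝ} (hl : 0 < lam)
    {g : EuclideanSpace ℝ (Fin n) → ℝ} (hg : IsAdmissibleFunction φ lam g) {R : ℝ} (hR : 0 < R) :
    ∫ x, g x * Real.exp (g x) ≤ (∫ x, fenchelLegendre φ (-(lam • ∇ g x)) * Real.exp (g x)) +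
      (Real.log (∫ x, Real.exp (g x)) -
        Real.log (∫⁻ u in cube n R, ENNReal.ofReal (Real.exp (-φ (WithLp.toLp 2 u)))).toReal -
        n - n * Real.log lam) * ∫ x, Real.exp (g x) := by
  have hgc := hg.contDiff.continuous
  have hgd : Differentiable ℝ g := hg.contDiff.differentiable one_ne_zero
  have hvol := PiLp.volume_preserving_toLp (Fin n)
  have hemb : MeasurableEmbedding (WithLp.toLp 2 : (Fin n → ℝ) → EuclideanSpace ℝ (Fin n)) :=
    (MeasurableEquiv.toLp 2 (Fin n → ℝ)).measurableEmbedding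
  have htoLp : Continuous (WithLp.toLp 2 : (Fin n → ℝ) → EuclideanSpace ℝ (Fin n)) :=
    PiLp.continuous_toLp 2 _
  set G : (Fin n → ℝ) → ℝ := fun x => g (WithLp.toLp 2 x) with hG
  set F : (Fin n → ℝ) → ℝ := fun x => Real.exp (G x) with hF
  set A : (Fin n → ℝ) → ℝ := fun x =>
    fenchelLegendre φ (-(lam • ∇ g (WithLp.toLp 2 x))) with hA
  let D : Fin n → (Fin n → ℝ) → ℝ := fun i x => F x * ∇ g (WithLp.toLp 2 x) i
  have hFi : Integrable F := (hvol.integrable_comp_emb hemb).2 hg.integrable_exp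
  have hGFi : Integrable fun x => G x * F x :=
    (hvol.integrable_comp_emb hemb).2 hg.integrable_mul_exp
  have hAFi : Integrable fun x => A x * F x :=
    (hvol.integrable_comp_emb hemb).2 hg.integrable_fenchel
  rw [← hvol.integral_comp hemb, ← hvol.integral_comp hemb (fun x => Real.exp (g x)),
    ← hvol.integral_comp hemb (fun x => fenchelLegendre φ (-(lam • ∇ g x)) * Real.exp (g x))]
  change ∫ x, G x * F x ≤ (∫ x, A x * F x) + (Real.log (∫ x, F x) - _ - _ - _) * ∫ x, F x
  have hDi : ∀ i, Integrable (D i) := fun i => by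
    obtain ⟨C, hC⟩ := exists_norm_le_fenchelLegendre hc hs
    refine Integrable.mono' ((hAFi.add (hFi.const_mul C)).const_mul lam⁻¹)
      (Continuous.aestronglyMeasurable ?_) (ae_of_all _ fun x => ?_)
    · refine (Real.continuous_exp.comp (hgc.comp htoLp)).mul ?_
      exact (continuous_apply i).comp ((PiLp.continuous_ofLp 2 _).comp
        ((continuous_gradient hg.contDiff).comp htoLp))
    · have h1 := hC (-(lam • ∇ g (WithLp.toLp 2 x)))
      rw [norm_neg, norm_smul, Real.norm_of_nonneg hl.le] at h1
      have h2 := PiLp.norm_apply_le (∇ g (WithLp.toLp 2 x)) i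
      have h3 : 0 < F x := Real.exp_pos _
      simp only [D, norm_mul, Real.norm_of_nonneg h3.le, Pi.add_apply]
      rw [← add_mul, ← mul_assoc, mul_comm]
      refine mul_le_mul_of_nonneg_right (h2.trans ?_) h3.le
      rw [inv_mul_eq_div, le_div_iff₀ hl, mul_comm]
      exact h1
  have hDer : ∀ i x t, HasDerivAt (fun t => F (Function.update x i t))
      (D i (Function.update x i t)) t := fun i x t => (hasDerivAt_comp_update hgd x i t).exp
  -- The parameter space served only the induction; here it is a point.
  let f : Unit → (Fin n → ℝ) → ℝ≥0∞ := fun _ x => ENNReal.ofReal (F x)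
  let ρ : Unit → (Fin n → ℝ) → ℝ≥0∞ := fun _ x =>
    ENNReal.ofReal (Real.exp (-φ (WithLp.toLp 2 x)))
  have hFc : Continuous F := Real.continuous_exp.comp (hgc.comp htoLp)
  have hρc : Continuous fun x : Fin n → ℝ => Real.exp (-φ (WithLp.toLp 2 x)) :=
    Real.continuous_exp.comp (hc.comp htoLp).neg
  obtain ⟨c, hcb⟩ := exists_linear_lower_bound hc hs 0
  obtain ⟨T, h, hTm, hhm, hTR, hTh, hid⟩ := exists_knothe hR n (f := f) (ρ := ρ)
    ((hFc.measurable.comp measurable_snd).ennreal_ofReal)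
    (fun _ x => by simp [f, hF, Real.exp_pos])
    ((hρc.measurable.comp measurable_snd).ennreal_ofReal)
    (fun _ x => by simp [ρ, Real.exp_pos]) (C := ENNReal.ofReal (Real.exp c))
    ENNReal.ofReal_ne_top (fun _ x => ENNReal.ofReal_le_ofReal
      (Real.exp_le_exp.2 (by linarith [hcb (WithLp.toLp 2 x)])))
  have hM : ∫⁻ x, f () x = ENNReal.ofReal (∫ x, F x) :=
    (ofReal_integral_eq_lintegral_ofReal hFi (ae_of_all _ fun x => (Real.exp_pos _).le)).symm
  have hMpos : 0 < ∫ x, F x := integral_exp_pos hFi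
  have hN1 : ∫⁻ u in cube n R, ρ () u ≠ ∞ := by
    refine ne_top_of_le_ne_top ENNReal.one_ne_top ((setLIntegral_le_lintegral _ _).trans ?_)
    rw [← lintegral_exp_neg_eq_one hp, ← hvol.lintegral_comp_emb hemb]
  have hN0 : ∫⁻ u in cube n R, ρ () u ≠ 0 := by
    refine ((setLIntegral_pos_iff hρc.measurable.ennreal_ofReal).2 ?_).ne'
    rw [(by ext y; simp [Real.exp_pos] : (Function.support fun x : Fin n → ℝ =>
      ENNReal.ofReal (Real.exp (-φ (WithLp.toLp 2 x)))) = univ), univ_inter]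
    exact volume_cube_pos n hR
  set N : ℝ := (∫⁻ u in cube n R, ρ () u).toReal with hN
  have hNpos : 0 < N := ENNReal.toReal_pos hN0 hN1
  change _ ≤ _ + (_ - Real.log N - _ - _) * _
  have hibp : ∀ i, Integrable (fun x => (h i () x).toReal * F x) ∧
      ∫ x, (h i () x).toReal * F x = -∫ x, T () x i * D i x := fun i => integral_density_mul_eq_neg_pi i (R := R)
    ((hhm i).comp (measurable_prodMk_left (x := ())))
    (T := fun x => T () x i)
    ((measurable_pi_apply i).comp (hTm.comp (measurable_prodMk_left (x := ()))))
    (fun x => mem_univ_pi.1 (hTR () x) i) (fun x t => hTh i () x t) (hDer i) hFi (hDi i)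
  have hTDi : ∀ i, Integrable fun x => T () x i * D i x := fun i =>
    (hDi i).bdd_mul ((measurable_pi_apply i).comp
      (hTm.comp (measurable_prodMk_left (x := ())))).aestronglyMeasurable (c := R)
      (ae_of_all _ fun x => abs_le.2 (mem_univ_pi.1 (hTR () x) i))
  -- Logarithm of the Jacobian identity, times `F = e^g`. The sum is `T · ∇F + F ∑ h i`, which has
  -- integral zero.
  have hpt : ∀ᵐ x, G x * F x ≤ A x * F x +
      lam * (∑ i, (T () x i * D i x + (h i () x).toReal * F x)) +
      (Real.log (∫ x, F x) - Real.log N - n - n * Real.log lam) * F x := by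
    filter_upwards [hid () (hM ▸ ENNReal.ofReal_ne_top)] with x hx
    have hFx : 0 < F x := Real.exp_pos _
    have e1 := congrArg ENNReal.toReal hx
    rw [hM] at e1
    simp only [ENNReal.toReal_mul, ENNReal.toReal_prod, f, ρ, ENNReal.toReal_ofReal hFx.le,
      ENNReal.toReal_ofReal hMpos.le, ENNReal.toReal_ofReal (Real.exp_pos _).le] at e1
    change F x * N = _ at e1
    have hne : ∏ i, (h i () x).toReal ≠ 0 := fun h0 => by
      rw [h0, mul_zero] at e1
      exact (mul_pos hFx hNpos).ne' e1
    have hpos : ∀ i, 0 < (h i () x).toReal := fun i =>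
      lt_of_le_of_ne ENNReal.toReal_nonneg (Finset.prod_ne_zero_iff.1 hne i (Finset.mem_univ i)).symm
    have e2 := congrArg Real.log e1
    rw [Real.log_mul hFx.ne' hNpos.ne', Real.log_mul (mul_pos (Real.exp_pos _) hMpos).ne' hne,
      Real.log_mul (Real.exp_pos _).ne' hMpos.ne', Real.log_exp,
      Real.log_prod (fun i _ => (hpos i).ne'), hF, Real.log_exp] at e2
    have e3 : ∑ i, Real.log (h i () x).toReal ≤
        lam * ∑ i, (h i () x).toReal - n - n * Real.log lam := by
      refine (Finset.sum_le_sum fun i _ => log_le_mul_sub hl (hpos i)).trans_eq ?_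
      simp [Finset.sum_sub_distrib, Finset.mul_sum]
    -- Fenchel-Young at the image point `T x`.
    have e4 := inner_sub_le_fenchelLegendre hc hs (-(lam • ∇ g (WithLp.toLp 2 x)))
      (WithLp.toLp 2 (T () x))
    have e5 : inner ℝ (-(lam • ∇ g (WithLp.toLp 2 x))) (WithLp.toLp 2 (T () x)) =
        -(lam * ∑ i, T () x i * ∇ g (WithLp.toLp 2 x) i) := by
      rw [inner_neg_left, real_inner_smul_left, PiLp.inner_apply]
      simp
    rw [e5] at e4
    have e6 : G x ≤ A x + lam * (∑ i, (T () x i * ∇ g (WithLp.toLp 2 x) i + (h i () x).toReal)) +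
        (Real.log (∫ x, F x) - Real.log N - n - n * Real.log lam) := by
      rw [Finset.sum_add_distrib, mul_add]
      simp only [hA]
      linarith
    refine (mul_le_mul_of_nonneg_right e6 hFx.le).trans_eq ?_
    rw [add_mul, add_mul, mul_assoc lam, Finset.sum_mul]
    simp only [D]
    congr 3
    refine Finset.sum_congr rfl fun i _ => ?_
    ring
  have hsum : ∀ i, Integrable fun x => T () x i * D i x + (h i () x).toReal * F x :=
    fun i => (hTDi i).add (hibp i).1
  have hsumi : Integrable fun x => ∑ i, (T () x i * D i x + (h i () x).toReal * F x) :=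
    integrable_finsetSum _ fun i _ => hsum i
  have hzero : ∫ x, ∑ i, (T () x i * D i x + (h i () x).toReal * F x) = 0 := by
    rw [integral_finsetSum _ fun i _ => hsum i]
    refine Finset.sum_eq_zero fun i _ => ?_
    rw [integral_add (hTDi i) (hibp i).1]
    rw [(hibp i).2, add_neg_cancel]
  have hle := integral_mono_ae hGFi ((hAFi.add (hsumi.const_mul lam)).add (hFi.const_mul _)) hpt
  refine hle.trans_eq ?_
  rw [integral_add' (hAFi.add (hsumi.const_mul lam)) (hFi.const_mul _),
    integral_add' hAFi (hsumi.const_mul lam), integral_const_mul, integral_const_mul, hzero]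
  ring

/-- The cubes exhaust the space; the side parameter `k + 1` keeps them nondegenerate from `k = 0`
on. -/
lemma tendsto_setLIntegral_cube {n : ℕ} {φ : EuclideanSpace ℝ (Fin n) → ℝ}
    (hp : IsProbabilityMeasure (potentialMeasure φ)) :
    Tendsto (fun k : ℕ => ∫⁻ u in cube n (k + 1),
      ENNReal.ofReal (Real.exp (-φ (WithLp.toLp 2 u)))) atTop (𝓝 1) := by
  have hvol := PiLp.volume_preserving_toLp (Fin n)
  have hemb : MeasurableEmbedding (WithLp.toLp 2 : (Fin n → ℝ) → EuclideanSpace ℝ (Fin n)) :=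
    (MeasurableEquiv.toLp 2 (Fin n → ℝ)).measurableEmbedding
  have hmono : Monotone fun k : ℕ => cube n (k + 1) := fun k l hkl =>
    pi_mono fun i _ => by
      have : (k : ℝ) ≤ l := Nat.cast_le.2 hkl
      exact Icc_subset_Icc (by linarith) (by linarith)
  have hunion : ⋃ k : ℕ, cube n ((k : ℝ) + 1) = univ := by
    refine eq_univ_of_forall fun x => mem_iUnion.2 ?_
    obtain ⟨k, hk⟩ := exists_nat_ge ‖x‖
    refine ⟨k, mem_univ_pi.2 fun i => ?_⟩
    have := (norm_le_pi_norm x i).trans hk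
    rw [Real.norm_eq_abs] at this
    exact abs_le.1 (by linarith)
  have h := tendsto_measure_iUnion_atTop (μ := volume.withDensity fun u : Fin n → ℝ =>
    ENNReal.ofReal (Real.exp (-φ (WithLp.toLp 2 u)))) hmono
  rw [hunion, withDensity_apply _ .univ, setLIntegral_univ,
    hvol.lintegral_comp_emb hemb (fun u => ENNReal.ofReal (Real.exp (-φ u))),
    lintegral_exp_neg_eq_one hp] at h
  refine h.congr fun k => ?_
  exact withDensity_apply _ (measurableSet_cube _ _)

theorem entropy_exp_le {n : ℕ} {φ : EuclideanSpace ℝ (Fin n) → ℝ} (hc : Continuous φ)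
    (hs : Tendsto (fun x => φ x / ‖x‖) (cocompact (EuclideanSpace ℝ (Fin n))) atTop)
    (hp : IsProbabilityMeasure (potentialMeasure φ)) {lam : ℝ} (hl : 0 < lam)
    {g : EuclideanSpace ℝ (Fin n) → ℝ} (hg : IsAdmissibleFunction φ lam g) :
    entropy volume (fun x => Real.exp (g x)) ≤
      -(n : ℝ) * Real.log (lam * Real.exp 1) * (∫ x, Real.exp (g x)) +
        ∫ x, fenchelLegendre φ (-(lam • ∇ g x)) * Real.exp (g x) := by
  rw [entropy_exp_eq hg.integrable_exp hg.integrable_mul_exp (integral_exp_pos hg.integrable_exp),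
    Real.log_mul hl.ne' (Real.exp_pos _).ne', Real.log_exp]
  have h1 := (ENNReal.continuousAt_toReal ENNReal.one_ne_top).tendsto.comp
    (tendsto_setLIntegral_cube hp)
  rw [ENNReal.toReal_one] at h1
  have h2 := (Real.continuousAt_log one_ne_zero).tendsto.comp h1
  rw [Real.log_one] at h2
  have h3 := ge_of_tendsto' (((((tendsto_const_nhds (x := Real.log (∫ x, Real.exp (g x)))).sub
    h2).sub_const (n : ℝ)).sub_const (n * Real.log lam)).mul_const
      (∫ x, Real.exp (g x)) |>.const_add
        (∫ x, fenchelLegendre φ (-(lam • ∇ g x)) * Real.exp (g x)))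
    fun k : ℕ => integral_mul_exp_le_of_cube hc hs hp hl hg (R := k + 1) (by positivity)
  linarith

/-! ### Equality for translates of the potential. -/

section potential

variable {n : ℕ} {φ : EuclideanSpace ℝ (Fin n) → ℝ}

lemma ConvexOn.add_inner_gradient_le (hφ : ConvexOn ℝ univ φ) (hd : Differentiable ℝ φ)
    (z w : EuclideanSpace ℝ (Fin n)) : φ z + inner ℝ (∇ φ z) (w - z) ≤ φ w := by
  have h1 : ConvexOn ℝ univ (φ ∘ AffineMap.lineMap z w : ℝ → ℝ) := hφ.comp_affineMap _
  have h2 : HasDerivAt (φ ∘ AffineMap.lineMap z w : ℝ → ℝ) (inner ℝ (∇ φ z) (w - z)) 0 := by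
    refine HasFDerivAt.comp_hasDerivAt (l' := InnerProductSpace.toDual ℝ _ (∇ φ z)) (0 : ℝ) ?_
      AffineMap.hasDerivAt_lineMap
    rw [AffineMap.lineMap_apply_zero]
    exact (hd z).hasGradientAt.hasFDerivAt
  have h3 := h1.le_slope_of_hasDerivAt (mem_univ 0) (mem_univ 1) one_pos h2
  simp only [slope_def_field, Function.comp_apply, AffineMap.lineMap_apply_one,
    AffineMap.lineMap_apply_zero, sub_zero, div_one] at h3
  linarith

/-- The tangent-plane inequality says that the supremum is attained at `z`. -/
lemma fenchelLegendre_gradient (hφ : ConvexOn ℝ univ φ) (hd : Differentiable ℝ φ)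
    (z : EuclideanSpace ℝ (Fin n)) :
    fenchelLegendre φ (∇ φ z) = inner ℝ (∇ φ z) z - φ z := by
  have hle : ∀ w, inner ℝ (∇ φ z) w - φ w ≤ inner ℝ (∇ φ z) z - φ z := fun w => by
    have := hφ.add_inner_gradient_le hd z w
    rw [inner_sub_right] at this
    linarith
  exact le_antisymm (ciSup_le hle) (le_ciSup (f := fun w => inner ℝ (∇ φ z) w - φ w)
    ⟨_, by rintro _ ⟨w, rfl⟩; exact hle w⟩ z)

lemma IsAdmissiblePotential.continuous (hφ : IsAdmissiblePotential φ) : Continuous φ := hφ.contDiff.continuous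

lemma IsAdmissiblePotential.differentiable (hφ : IsAdmissiblePotential φ) : Differentiable ℝ φ :=
  hφ.contDiff.differentiable two_ne_zero

lemma IsAdmissiblePotential.continuous_exp_neg (hφ : IsAdmissiblePotential φ) : Continuous fun z => Real.exp (-φ z) :=
  Real.continuous_exp.comp hφ.continuous.neg

lemma IsAdmissiblePotential.contDiff_one (hφ : IsAdmissiblePotential φ) : ContDiff ℝ 1 φ := hφ.contDiff.of_le one_le_two

lemma IsAdmissiblePotential.integrable_exp_neg (hφ : IsAdmissiblePotential φ) : Integrable fun z => Real.exp (-φ z) := by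
  refine ⟨hφ.continuous_exp_neg.aestronglyMeasurable, ?_⟩
  rw [hasFiniteIntegral_iff_ofReal (ae_of_all _ fun _ => (Real.exp_pos _).le),
    lintegral_exp_neg_eq_one hφ.isProbabilityMeasure]
  exact ENNReal.one_lt_top

lemma IsAdmissiblePotential.integral_exp_neg (hφ : IsAdmissiblePotential φ) : ∫ z, Real.exp (-φ z) = 1 := by
  rw [integral_eq_lintegral_of_nonneg_ae (ae_of_all _ fun _ => (Real.exp_pos _).le)
    hφ.continuous_exp_neg.aestronglyMeasurable, lintegral_exp_neg_eq_one hφ.isProbabilityMeasure,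
    ENNReal.toReal_one]

lemma IsAdmissiblePotential.integrable_norm_mul_norm_gradient (hφ : IsAdmissiblePotential φ) :
    Integrable fun z => ‖z‖ * ‖∇ φ z‖ * Real.exp (-φ z) := by
  have hcont := continuous_gradient hφ.contDiff_one
  refine ⟨((continuous_norm.mul hcont.norm).mul hφ.continuous_exp_neg).aestronglyMeasurable, ?_⟩
  -- With `y₀ = id` and `R = 1` the weight is `(2‖z‖ + 1)²`, which dominates `‖z‖`; the Hessian term
  -- is discarded.
  have h := hφ.moment 1 one_pos id measurable_id (fun z => by simp)
  have h2 : ∫⁻ z, ‖z‖ₑ * ‖∇ φ z‖ₑ ∂(potentialMeasure φ) < ∞ := by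
    refine lt_of_le_of_lt (lintegral_mono fun z => ?_) h
    refine mul_le_mul' ?_ le_self_add
    rw [ENNReal.ofReal_one, id, sq]
    calc ‖z‖ₑ ≤ ‖z‖ₑ + ‖z‖ₑ + 1 := le_self_add.trans le_self_add
      _ = (‖z‖ₑ + ‖z‖ₑ + 1) * 1 := (mul_one _).symm
      _ ≤ _ := mul_le_mul' le_rfl le_add_self
  rw [potentialMeasure, lintegral_withDensity_eq_lintegral_mul _
    hφ.continuous_exp_neg.measurable.ennreal_ofReal
    (g := fun z => ‖z‖ₑ * ‖∇ φ z‖ₑ) (measurable_enorm.mul hcont.measurable.enorm)] at h2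
  refine lt_of_eq_of_lt (lintegral_congr fun z => ?_) h2
  simp only [Pi.mul_apply, enorm_mul, enorm_norm, Real.enorm_eq_ofReal (Real.exp_pos _).le]
  ring

lemma IsAdmissiblePotential.integrable_mul_exp_neg (hφ : IsAdmissiblePotential φ) :
    Integrable fun z => φ z * Real.exp (-φ z) := by
  obtain ⟨c, hc⟩ := exists_linear_lower_bound hφ.continuous hφ.superlinear 0
  refine Integrable.mono' (hφ.integrable_norm_mul_norm_gradient.add
    (hφ.integrable_exp_neg.const_mul (|c| + |φ 0|)))
    (hφ.continuous.mul hφ.continuous_exp_neg).aestronglyMeasurable (ae_of_all _ fun z => ?_)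
  -- The tangent plane at `z`, evaluated at `0`, bounds `φ z` above by `φ 0 + ‖z‖ ‖∇φ z‖`.
  have h1 := hφ.strictConvexOn.convexOn.add_inner_gradient_le hφ.differentiable z 0
  rw [zero_sub, inner_neg_right] at h1
  have h2 := real_inner_le_norm (∇ φ z) z
  rw [norm_mul, Real.norm_of_nonneg (Real.exp_pos _).le, Pi.add_apply, ← add_mul]
  refine mul_le_mul_of_nonneg_right ?_ (Real.exp_pos _).le
  have h3 : 0 ≤ ‖z‖ * ‖∇ φ z‖ := by positivity
  rw [Real.norm_eq_abs, abs_le]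
  constructor
  · linarith [hc z, le_abs_self c, abs_nonneg (φ 0)]
  · linarith [le_abs_self (φ 0), abs_nonneg c]

lemma IsAdmissiblePotential.integrable_norm_mul_exp_neg (hφ : IsAdmissiblePotential φ) :
    Integrable fun z => ‖z‖ * Real.exp (-φ z) := by
  obtain ⟨c, hc⟩ := exists_linear_lower_bound hφ.continuous hφ.superlinear 1
  refine Integrable.mono' (hφ.integrable_mul_exp_neg.add (hφ.integrable_exp_neg.const_mul c))
    (continuous_norm.mul hφ.continuous_exp_neg).aestronglyMeasurable (ae_of_all _ fun z => ?_)
  rw [norm_mul, norm_norm, Real.norm_of_nonneg (Real.exp_pos _).le, Pi.add_apply, ← add_mul]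
  exact mul_le_mul_of_nonneg_right (by linarith [hc z]) (Real.exp_pos _).le

lemma IsAdmissiblePotential.integrable_inner_gradient (hφ : IsAdmissiblePotential φ) :
    Integrable fun z => inner ℝ (∇ φ z) z * Real.exp (-φ z) := by
  refine Integrable.mono' hφ.integrable_norm_mul_norm_gradient
    (((continuous_gradient hφ.contDiff_one).inner continuous_id).mul
      hφ.continuous_exp_neg).aestronglyMeasurable (ae_of_all _ fun z => ?_)
  rw [norm_mul, Real.norm_of_nonneg (Real.exp_pos _).le, mul_comm ‖z‖]
  exact mul_le_mul_of_nonneg_right (norm_inner_le_norm _ _) (Real.exp_pos _).le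

/-- The field `z e^{-φ}` has divergence `(n - ∇φ(z) · z) e^{-φ}`; each coordinate contributes `∫
e^{-φ} = 1`. -/
lemma IsAdmissiblePotential.integral_inner_gradient (hφ : IsAdmissiblePotential φ) :
    ∫ z, inner ℝ (∇ φ z) z * Real.exp (-φ z) = n := by
  have hder : ∀ i : Fin n, ∀ z, HasLineDerivAt ℝ (fun z => Real.exp (-φ z))
      (-(∇ φ z i * Real.exp (-φ z))) z (EuclideanSpace.single i 1) := fun i z => by
    have h1 := ((hφ.differentiable z).hasGradientAt.hasFDerivAt.neg.exp).hasLineDerivAt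
      (EuclideanSpace.single i (1 : ℝ))
    have h2 : InnerProductSpace.toDual ℝ _ (∇ φ z) (EuclideanSpace.single i (1 : ℝ)) = ∇ φ z i := by
      rw [InnerProductSpace.toDual_apply_apply, EuclideanSpace.inner_single_right, one_mul]
      rfl
    have h3 : -(∇ φ z i * Real.exp (-φ z)) = (Real.exp ((-φ) z) •
        -(InnerProductSpace.toDual ℝ _ (∇ φ z))) (EuclideanSpace.single i (1 : ℝ)) := by
      change _ = Real.exp (-φ z) *
        -(InnerProductSpace.toDual ℝ _ (∇ φ z) (EuclideanSpace.single i (1 : ℝ)))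
      rw [h2]
      ring
    rw [h3]
    exact h1
  have hcoord : ∀ i : Fin n, ∀ z : EuclideanSpace ℝ (Fin n),
      HasLineDerivAt ℝ (fun z : EuclideanSpace ℝ (Fin n) => z i) 1 z
        (EuclideanSpace.single i 1) := fun i z => by
    have h1 := (EuclideanSpace.proj i : EuclideanSpace ℝ (Fin n) →L[ℝ] ℝ).hasFDerivAt (x := z)
      |>.hasLineDerivAt (EuclideanSpace.single i (1 : ℝ))
    simpa using! h1
  have hi1 : ∀ i : Fin n, Integrable fun z => z i * Real.exp (-φ z) := fun i =>
    hφ.integrable_norm_mul_exp_neg.mono (Continuous.aestronglyMeasurable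
      (((EuclideanSpace.proj i : EuclideanSpace ℝ (Fin n) →L[ℝ] ℝ).continuous).mul
        hφ.continuous_exp_neg)) (ae_of_all _ fun z => by
      rw [norm_mul, norm_mul, norm_norm]
      exact mul_le_mul_of_nonneg_right (PiLp.norm_apply_le z i) (norm_nonneg _))
  have hi2 : ∀ i : Fin n, Integrable fun z => z i * -(∇ φ z i * Real.exp (-φ z)) := fun i =>
    hφ.integrable_norm_mul_norm_gradient.mono (Continuous.aestronglyMeasurable
      (((EuclideanSpace.proj i : EuclideanSpace ℝ (Fin n) →L[ℝ] ℝ).continuous).mul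
        (((EuclideanSpace.proj i : EuclideanSpace ℝ (Fin n) →L[ℝ] ℝ).continuous.comp
          (continuous_gradient hφ.contDiff_one)).mul hφ.continuous_exp_neg).neg))
      (ae_of_all _ fun z => by
        rw [norm_mul, norm_neg, norm_mul, norm_mul, norm_mul, norm_norm, norm_norm, mul_assoc]
        gcongr
        · exact PiLp.norm_apply_le z i
        · exact PiLp.norm_apply_le (∇ φ z) i)
  have hibp : ∀ i : Fin n, ∫ z, z i * -(∇ φ z i * Real.exp (-φ z)) = -1 := fun i => by
    have := integral_bilinear_hasLineDerivAt_right_eq_neg_left_of_integrable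
      (μ := (volume : Measure (EuclideanSpace ℝ (Fin n)))) (B := ContinuousLinearMap.mul ℝ ℝ)
      (f := fun z : EuclideanSpace ℝ (Fin n) => z i) (f' := fun _ => 1)
      (g := fun z => Real.exp (-φ z)) (by simpa using hφ.integrable_exp_neg)
      (by simpa using! hi2 i) (by simpa using hi1 i) (fun z _ => hcoord i z) (fun z _ => hder i z)
    simpa [hφ.integral_exp_neg] using! this
  have hsum : ∀ z, inner ℝ (∇ φ z) z * Real.exp (-φ z) =
      ∑ i, -(z i * -(∇ φ z i * Real.exp (-φ z))) := fun z => by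
    rw [PiLp.inner_apply, Finset.sum_mul]
    refine Finset.sum_congr rfl fun i _ => ?_
    simp only [RCLike.inner_apply, conj_trivial]
    ring
  simp only [hsum]
  rw [integral_finsetSum _ fun i _ => (hi2 i).fun_neg]
  simp only [integral_neg, hibp]
  simp

/-- After translation, `φ*(-∇g) = ∇φ(z) · z - φ(z)` has integral `n - ∫ φ e^{-φ}`, so both sides
equal `-∫ φ e^{-φ}`. -/
lemma IsAdmissiblePotential.isAdmissibleFunction_and_entropy_eq
    (hφ : IsAdmissiblePotential φ) (xbar : EuclideanSpace ℝ (Fin n)) {g : EuclideanSpace ℝ (Fin n) → ℝ}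
    (hg : ∀ x, g x = -φ (x - xbar)) :
    IsAdmissibleFunction φ 1 g ∧
      entropy volume (fun x => Real.exp (g x)) =
        -(n : ℝ) * Real.log (1 * Real.exp 1) * (∫ x, Real.exp (g x)) +
          ∫ x, fenchelLegendre φ (-((1 : ℝ) • ∇ g x)) * Real.exp (g x) := by
  obtain rfl : g = fun x => -φ (x - xbar) := funext hg
  have hgrad : ∀ x, ∇ (fun x => -φ (x - xbar)) x = -∇ φ (x - xbar) := fun x => by
    refine HasGradientAt.gradient (hasGradientAt_iff_hasFDerivAt.2 ?_)
    rw [map_neg]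
    exact ((hasFDerivAt_comp_sub xbar).2
      (hφ.differentiable (x - xbar)).hasGradientAt.hasFDerivAt).neg
  have hfen : ∀ x, fenchelLegendre φ (-((1 : ℝ) • ∇ (fun x => -φ (x - xbar)) x)) *
      Real.exp (-φ (x - xbar)) = (fun z => inner ℝ (∇ φ z) z * Real.exp (-φ z) -
        φ z * Real.exp (-φ z)) (x - xbar) := fun x => by
    rw [hgrad, one_smul, neg_neg,
      fenchelLegendre_gradient hφ.strictConvexOn.convexOn hφ.differentiable, sub_mul]
  have hadm : IsAdmissibleFunction φ 1 fun x => -φ (x - xbar) :=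
    { contDiff := (hφ.contDiff_one.comp (contDiff_id.sub contDiff_const)).neg
      integrable_exp := hφ.integrable_exp_neg.comp_sub_right xbar
      integrable_mul_exp := by
        simpa using! (hφ.integrable_mul_exp_neg.comp_sub_right xbar).neg
      integrable_fenchel := by
        simp only [hfen]
        exact (hφ.integrable_inner_gradient.sub hφ.integrable_mul_exp_neg).comp_sub_right xbar }
  refine ⟨hadm, ?_⟩
  have h1 : ∫ x, Real.exp (-φ (x - xbar)) = 1 := by
    rw [integral_sub_right_eq_self (fun x => Real.exp (-φ x)), hφ.integral_exp_neg]
  rw [entropy_exp_eq hadm.integrable_exp hadm.integrable_mul_exp (h1 ▸ one_pos)]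
  simp only [hfen, h1]
  rw [integral_sub_right_eq_self (fun z => inner ℝ (∇ φ z) z * Real.exp (-φ z) -
      φ z * Real.exp (-φ z)), integral_sub hφ.integrable_inner_gradient hφ.integrable_mul_exp_neg,
    hφ.integral_inner_gradient, integral_sub_right_eq_self (fun z => -φ z * Real.exp (-φ z))]
  simp only [neg_mul, integral_neg, one_mul, Real.log_exp, Real.log_one]
  ring

end potential

end

theorem mainTheorem3 {n : ℕ} (φ : EuclideanSpace ℝ (Fin n) → ℝ)
    (hφ : IsAdmissiblePotential φ) :
    (∀ lam : ℝ, 0 < lam → ∀ g : EuclideanSpace ℝ (Fin n) → ℝ,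
      IsAdmissibleFunction φ lam g →
      entropy volume (fun x => Real.exp (g x)) ≤
        -(n : ℝ) * Real.log (lam * Real.exp 1) * (∫ x, Real.exp (g x)) +
          ∫ x, fenchelLegendre φ (-(lam • ∇ g x)) * Real.exp (g x)) ∧
    (∀ (xbar : EuclideanSpace ℝ (Fin n)) (g : EuclideanSpace ℝ (Fin n) → ℝ),
      (∀ x, g x = -φ (x - xbar)) →
      IsAdmissibleFunction φ 1 g ∧
      entropy volume (fun x => Real.exp (g x)) =
        -(n : ℝ) * Real.log (1 * Real.exp 1) * (∫ x, Real.exp (g x)) +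
          ∫ x, fenchelLegendre φ (-((1 : ℝ) • ∇ g x)) * Real.exp (g x)) := by
  exact ⟨fun _ hl _ hg => entropy_exp_le hφ.continuous hφ.superlinear hφ.isProbabilityMeasure hl hg,
    fun xbar _ hg => hφ.isAdmissibleFunction_and_entropy_eq xbar hg⟩
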